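/- Call a function $V:\mathbb R^n\to\mathbb R$ a Lyapunov function for a system $\dot x=f(x)$ on $\mathbb R^n$ if $V$ is continuously differentiable, $V(0)=0$, $V(x)\to\infty$ as $\|x\|\to\infty$, and $V(x)>0$ and $-\langle\nabla V(x),f(x)\rangle>0$ for all $x\neq 0$. It is rational with numerator $p$ and denominator $q$ if $p,q$ are real polynomials, $q\not\equiv 0$, and $V=p/q$ wherever $q\neq 0$. Let $\lambda$ be a positive irrational real number and consider the following homogeneous cubic vector field on $\mathbb R^2$, parameterized by $\theta\in\mathbb R$: $$\begin{pmatrix}\dot x\\ \dot y\end{pmatrix}=\begin{pmatrix}\cos\theta&-\sin\theta\\ \sin\theta&\cos\theta\end{pmatrix}\begin{pmatrix}-2\lambda y(x^2+y^2)-2y(2x^2+y^2)\\ 4\lambda x(x^2+y^2)+2x(2x^2+y^2)\end{pmatrix}.$$ Then for every $\theta\in(0,\pi)$ the origin is (globally) asymptotically stable: solutions exist on $[0,\infty)$ from every initial condition, the origin is stable in the sense of Lyapunov, and every solution tends to the origin as $t\to\infty$. However, for every nonnegative integer $s$ there exists $\theta\in(0,\pi)$ such that the vector field admits no rational Lyapunov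 function whose numerator is a homogeneous polynomial of degree at most $s$ and whose denominator is a homogeneous polynomial (of any degree, nonzero constants included). Consequently, there is no function $B:\mathbb N\times\mathbb N\to\mathbb N$ such that, for all $n$ and all $d\ge 1$, every (globally) asymptotically stable vector field on $\mathbb R^n$ whose components are homogeneous polynomials of degree $d$ admits a rational Lyapunov function whose numerator is a homogeneous polynomial of degree at most $B(n,d)$ and whose denominator is a homogeneous polynomial. -/

import Mathlib

open Filter Topology

/-- `ℝⁿ` with the Euclidean norm. -/
abbrev Euc (n : ℕ) : Type := EuclideanSpace ℝ (Fin n)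

/-- `x` is a (forward) solution of `ẋ = f(x)` on `[0, ∞)`; the derivative at `0` is one-sided. -/
def IsForwardSolution {n : ℕ} (f : Euc n → Euc n) (x : ℝ → Euc n) : Prop :=
  ∀ t : ℝ, 0 ≤ t → HasDerivWithinAt x (f (x t)) (Set.Ici 0) t

/-- The origin is stable in the sense of Lyapunov: for every `ε > 0` there is `δ > 0` such that
all solutions with `‖x(0)‖ < δ` satisfy `‖x(t)‖ < ε` for all `t ≥ 0`. -/
def LyapunovStable {n : ℕ} (f : Euc n → Euc n) : Prop :=
  ∀ ε : ℝ, 0 < ε → ∃ δ : ℝ, 0 < δ ∧ ∀ x : ℝ → Euc n,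
    IsForwardSolution f x → ‖x 0‖ < δ → ∀ t : ℝ, 0 ≤ t → ‖x t‖ < ε

/-- The origin is (globally) asymptotically stable: from every initial condition there is a
solution on `[0, ∞)` (no finite-time blow-up), the origin is stable in the sense of Lyapunov, and
every solution tends to the origin. For homogeneous vector fields, local and global asymptotic
stability are equivalent. -/
def AsymptoticallyStable {n : ℕ} (f : Euc n → Euc n) : Prop :=
  (∀ x₀ : Euc n, ∃ x : ℝ → Euc n, IsForwardSolution f x ∧ x 0 = x₀) ∧
  LyapunovStable f ∧
  ∀ x : ℝ → Euc n, IsForwardSolution f x → Tendsto x atTop (𝓝 0)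

/-- `V` is a Lyapunov function for `ẋ = f(x)`: it is continuously differentiable, radially
unbounded, zero at the origin, and both `V` and `-⟨∇V, f⟩` are positive off the origin. -/
structure IsLyapunovFunction {n : ℕ} (f : Euc n → Euc n) (V : Euc n → ℝ) : Prop where
  contDiff : ContDiff ℝ 1 V
  radiallyUnbounded : Tendsto V (Bornology.cobounded (Euc n)) atTop
  zero : V 0 = 0
  pos : ∀ x : Euc n, x ≠ 0 → 0 < V x
  decreasing : ∀ x : Euc n, x ≠ 0 → 0 < -(inner ℝ (gradient V x) (f x))

/-- `ẋ = f(x)` has a Lyapunov function `V = p / q` where `p` is a homogeneous polynomial of degree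
at most `s` and `q` is a nonzero homogeneous polynomial (of any degree, constants included).
The formula `V = p / q` is required where `q` does not vanish, which is a dense open set; elsewhere
(for instance at the origin) `V` is the continuous extension. -/
def HasRationalLyapunov {n : ℕ} (f : Euc n → Euc n) (s : ℕ) : Prop :=
  ∃ p q : MvPolynomial (Fin n) ℝ,
    (∃ a : ℕ, a ≤ s ∧ p.IsHomogeneous a) ∧
    (∃ b : ℕ, q.IsHomogeneous b) ∧ q ≠ 0 ∧
    ∃ V : Euc n → ℝ, IsLyapunovFunction f V ∧
      ∀ x : Euc n, MvPolynomial.eval (fun i => x i) q ≠ 0 →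
        V x = MvPolynomial.eval (fun i => x i) p / MvPolynomial.eval (fun i => x i) q

/-- The vector field on `ℝⁿ` with polynomial components `F 0, …, F (n - 1)`. -/
noncomputable def polyField {n : ℕ} (F : Fin n → MvPolynomial (Fin n) ℝ) : Euc n → Euc n :=
  fun x => WithLp.toLp 2 (fun i => MvPolynomial.eval (fun j => x j) (F i))

/-- The planar homogeneous cubic vector field with parameters `lam` and `θ`: the field
`(-2λy(x²+y²) - 2y(2x²+y²), 4λx(x²+y²) + 2x(2x²+y²))` rotated by the angle `θ`. -/
noncomputable def rotatedCubic (lam θ : ℝ) : Euc 2 → Euc 2 :=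
  fun z => WithLp.toLp 2
    (Matrix.mulVec
      !![Real.cos θ, -Real.sin θ;
         Real.sin θ,  Real.cos θ]
      ![-2 * lam * z 1 * (z 0 ^ 2 + z 1 ^ 2) - 2 * z 1 * (2 * z 0 ^ 2 + z 1 ^ 2),
        4 * lam * z 0 * (z 0 ^ 2 + z 1 ^ 2) + 2 * z 0 * (2 * z 0 ^ 2 + z 1 ^ 2)])

/-! Write `u = 2x² + y²`, `r = x² + y²`, `W = u ^ lam * r`, and let `G` be the positive multiple of
`∇W` in `gradX`, `gradY`. The field is `cos θ` times the quarter turn of `G` minus `sin θ` times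
`G`. For `θ` in `(0, π)` a power of `W` therefore decreases strictly, and Lyapunov's theorem gives
stability. At `θ = 0` the function `W` is a first integral and its level curves are closed.

Suppose that degree `s` sufficed for every `θ`. Let `θ = 1 / (n + 1)` tend to `0`. Normalized
coefficients of the dehomogenized numerators and denominators subconverge to nonzero `P`, `Q`
(`exists_coeff_of_hasRationalLyapunov`). In the limit `P / Q` is only weakly decreasing along the
field at `θ = 0`. Weak decrease around a closed orbit forces constancy (`log_deriv_eq_of_le`), so
`(P / Q)²` has the logarithmic derivative of a power of `W`. Comparing orders at a complex zero of
`u` and one of `r` exhibits `lam` as a ratio of integers (`false_of_log_deriv_eq`), contradicting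
irrationality. -/

/-! ### Lyapunov's theorem on `ℝⁿ` -/

/-- A compactly supported `C¹` vector field has a solution on `[0, ∞)` from every initial
condition. -/
theorem exists_isForwardSolution_of_hasCompactSupport {n : ℕ} {f : Euc n → Euc n}
    (hf : ContDiff ℝ 1 f) (hc : HasCompactSupport f) (x₀ : Euc n) :
    ∃ x : ℝ → Euc n, IsForwardSolution f x ∧ x 0 = x₀ := by
  obtain ⟨K, hK⟩ := ContDiff.lipschitzWith_of_hasCompactSupport hc hf one_ne_zero
  obtain ⟨C, hC⟩ := hc.exists_bound_of_continuous hf.continuous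
  have hlocal : ∀ a : ℕ, ∃ α : ℝ → Euc n, α 0 = x₀ ∧
      ∀ t ∈ Set.Icc (0 : ℝ) a, HasDerivWithinAt α (f (α t)) (Set.Icc (0 : ℝ) a) t := by
    intro a
    have h0 : (0 : ℝ) ∈ Set.Icc (0 : ℝ) a := ⟨le_rfl, Nat.cast_nonneg a⟩
    -- The global bound `C` on the field lets the ball have radius `C * a`, so the local theorem
    -- reaches any time `a`.
    have hpl : IsPicardLindelof (fun _ => f) (⟨0, h0⟩ : Set.Icc (0 : ℝ) a) x₀
        (C.toNNReal * a) 0 C.toNNReal K :=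
      { lipschitzOnWith := fun t _ => hK.lipschitzOnWith
        continuousOn := fun x _ => continuousOn_const
        norm_le := fun t _ x _ => (hC x).trans (Real.le_coe_toNNReal C)
        mul_max_le := by simp }
    exact hpl.exists_eq_forall_mem_Icc_hasDerivWithinAt₀
  choose α hα0 hα using hlocal
  have hcont : ∀ a : ℕ, ContinuousOn (α a) (Set.Icc (0 : ℝ) a) :=
    fun a t ht => (hα a t ht).continuousWithinAt
  have hright : ∀ a : ℕ, ∀ t ∈ Set.Ico (0 : ℝ) a,
      HasDerivWithinAt (α a) (f (α a t)) (Set.Ici t) t := by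
    intro a t ht
    refine (hα a t ⟨ht.1, ht.2.le⟩).mono_of_mem_nhdsWithin ?_
    exact mem_of_superset (Icc_mem_nhdsGE ht.2) (Set.Icc_subset_Icc_left ht.1)
  have hagree : ∀ a b : ℕ, a ≤ b → Set.EqOn (α a) (α b) (Set.Icc (0 : ℝ) a) := by
    intro a b hab
    have hab' : (a : ℝ) ≤ b := by exact_mod_cast hab
    exact ODE_solution_unique_of_mem_Icc_right (v := fun _ => f) (s := fun _ => Set.univ) (K := K)
      (fun t _ => hK.lipschitzOnWith) (hcont a) (hright a) (fun _ _ => Set.mem_univ _)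
      ((hcont b).mono (Set.Icc_subset_Icc_right hab'))
      (fun t ht => hright b t ⟨ht.1, ht.2.trans_le hab'⟩)
      (fun _ _ => Set.mem_univ _) ((hα0 a).trans (hα0 b).symm)
  have hglue : ∀ (a : ℕ) (t : ℝ), t ∈ Set.Icc (0 : ℝ) a → α (⌈t⌉₊) t = α a t := by
    intro a t ht
    exact hagree _ _ (Nat.ceil_le.2 ht.2) ⟨ht.1, Nat.le_ceil t⟩
  refine ⟨fun t => α ⌈t⌉₊ t, fun t ht => ?_, by simp [hα0]⟩
  obtain ⟨a, ha⟩ := exists_nat_gt t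
  have htm : t ∈ Set.Icc (0 : ℝ) a := ⟨ht, ha.le⟩
  have h1 : HasDerivWithinAt (fun t => α ⌈t⌉₊ t) (f (α a t)) (Set.Icc (0 : ℝ) a) t :=
    (hα a t htm).congr (fun y hy => hglue a y hy) (hglue a t htm)
  rw [← hglue a t htm] at h1
  refine h1.mono_of_mem_nhdsWithin ?_
  rw [← Set.Ici_inter_Iic]
  exact inter_mem self_mem_nhdsWithin (mem_nhdsWithin_of_mem_nhds (Iic_mem_nhds ha))

/-- A differentiable function whose derivative along a vector field is nonpositive is nonincreasing
along forward solutions. -/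
theorem IsForwardSolution.antitoneOn {n : ℕ} {f : Euc n → Euc n} {x : ℝ → Euc n}
    (hx : IsForwardSolution f x) {V : Euc n → ℝ} (hV : Differentiable ℝ V)
    (hVf : ∀ y, fderiv ℝ V y (f y) ≤ 0) : AntitoneOn (V ∘ x) (Set.Ici 0) := by
  have hd : ∀ t ∈ Set.Ici (0 : ℝ),
      HasDerivWithinAt (V ∘ x) (fderiv ℝ V (x t) (f (x t))) (Set.Ici 0) t := fun t ht =>
    (hV (x t)).hasFDerivAt.comp_hasDerivWithinAt t (hx t ht)
  refine antitoneOn_of_hasDerivWithinAt_nonpos (f' := fun t => fderiv ℝ V (x t) (f (x t)))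
    (convex_Ici 0) (fun t ht => (hd t ht).continuousWithinAt) (fun t ht => ?_) (fun t _ => hVf _)
  exact (hd t (interior_subset ht)).mono interior_subset

namespace IsLyapunovFunction

variable {n : ℕ} {f : Euc n → Euc n} {V : Euc n → ℝ}

theorem fderiv_apply_neg (h : IsLyapunovFunction f V) {x : Euc n} (hx : x ≠ 0) :
    fderiv ℝ V x (f x) < 0 := by
  simpa using h.decreasing x hx

theorem nonneg (h : IsLyapunovFunction f V) (x : Euc n) : 0 ≤ V x := by
  rcases eq_or_ne x 0 with rfl | hx
  · exact h.zero.ge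
  · exact (h.pos x hx).le

theorem fderiv_apply_nonpos (h : IsLyapunovFunction f V) (x : Euc n) :
    fderiv ℝ V x (f x) ≤ 0 := by
  rcases eq_or_ne x 0 with rfl | hx
  · have hmin : IsLocalMin V 0 := Eventually.of_forall fun y => by
      simpa [h.zero] using h.nonneg y
    simp [hmin.fderiv_eq_zero]
  · exact (h.fderiv_apply_neg hx).le

theorem differentiable (h : IsLyapunovFunction f V) : Differentiable ℝ V :=
  h.contDiff.differentiable one_ne_zero

theorem isCompact_sublevel (h : IsLyapunovFunction f V) (c : ℝ) : IsCompact {x | V x ≤ c} := by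
  refine Metric.isCompact_of_isClosed_isBounded
    (isClosed_le h.contDiff.continuous continuous_const) ?_
  rw [Bornology.isBounded_def]
  filter_upwards [h.radiallyUnbounded.eventually_gt_atTop c] with x hx
  simpa using hx

/-- `V` has a positive minimum on the compact set where `V ≤ 1` and `ε ≤ ‖x‖`; below it (and below
`1`) no point of norm at least `ε` remains. -/
theorem exists_forall_lt (h : IsLyapunovFunction f V) {ε : ℝ} (hε : 0 < ε) :
    ∃ m : ℝ, 0 < m ∧ ∀ x, V x < m → ‖x‖ < ε := by
  have hK : IsCompact ({x | V x ≤ 1} ∩ {x : Euc n | ε ≤ ‖x‖}) :=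
    (h.isCompact_sublevel 1).inter_right (isClosed_le continuous_const continuous_norm)
  rcases Set.eq_empty_or_nonempty ({x | V x ≤ 1} ∩ {x : Euc n | ε ≤ ‖x‖}) with he | hne
  · refine ⟨1, one_pos, fun x hx => ?_⟩
    by_contra! hcon
    exact (Set.eq_empty_iff_forall_notMem.1 he x) ⟨le_of_lt hx, hcon⟩
  · obtain ⟨z, hz, hmin⟩ := hK.exists_isMinOn hne h.contDiff.continuous.continuousOn
    have hz0 : z ≠ 0 := by
      rintro rfl
      have : ε ≤ ‖(0 : Euc n)‖ := hz.2
      rw [norm_zero] at this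
      linarith
    refine ⟨min 1 (V z), lt_min one_pos (h.pos z hz0), fun x hx => ?_⟩
    by_contra! hcon
    exact absurd (hmin ⟨(hx.trans_le (min_le_left _ _)).le, hcon⟩)
      (not_le.2 (hx.trans_le (min_le_right _ _)))

theorem lyapunovStable (h : IsLyapunovFunction f V) : LyapunovStable f := by
  intro ε hε
  obtain ⟨m, hm, hball⟩ := h.exists_forall_lt hε
  have hev : ∀ᶠ y in 𝓝 (0 : Euc n), V y < m :=
    h.contDiff.continuous.continuousAt.eventually_lt continuousAt_const (by simpa [h.zero])
  obtain ⟨δ, hδ, hd⟩ := Metric.eventually_nhds_iff.1 hev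
  refine ⟨δ, hδ, fun x hx hx0 t ht => hball _ (lt_of_le_of_lt ?_ (hd (y := x 0) (by simpa)))⟩
  exact hx.antitoneOn h.differentiable h.fderiv_apply_nonpos Set.self_mem_Ici ht ht

theorem tendsto_zero (h : IsLyapunovFunction f V) (hf : Continuous f) {x : ℝ → Euc n}
    (hx : IsForwardSolution f x) : Tendsto x atTop (𝓝 0) := by
  have hanti := hx.antitoneOn h.differentiable h.fderiv_apply_nonpos
  have hsmall : ∀ c : ℝ, 0 < c → ∃ T : ℝ, 0 ≤ T ∧ V (x T) < c := by
    intro c hc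
    by_contra! hcon
    have hg : Continuous fun y => fderiv ℝ V y (f y) :=
      (h.contDiff.continuous_fderiv one_ne_zero).clm_apply hf
    have hK : IsCompact ({y | V y ≤ V (x 0)} ∩ {y | c ≤ V y}) :=
      (h.isCompact_sublevel _).inter_right (isClosed_le continuous_const h.contDiff.continuous)
    have hmem : ∀ t, 0 ≤ t → x t ∈ ({y | V y ≤ V (x 0)} ∩ {y | c ≤ V y}) := fun t ht =>
      ⟨hanti Set.self_mem_Ici ht ht, hcon t ht⟩
    obtain ⟨z, hz, hmax⟩ := hK.exists_isMaxOn ⟨_, hmem 0 le_rfl⟩ hg.continuousOn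
    have hz0 : z ≠ 0 := by
      rintro rfl
      have : c ≤ V 0 := hz.2
      rw [h.zero] at this
      linarith
    have hneg := h.fderiv_apply_neg hz0
    -- `D < 0` is the largest derivative of `V` along the field on the compact shell, so `V (x t) ≤
    -- V (x 0) + D * t`. At time `V (x 0) / -D` this contradicts `c ≤ V`.
    set D := fderiv ℝ V z (f z) with hD
    have hanti2 : AntitoneOn (fun t => V (x t) - D * t) (Set.Ici 0) := by
      have hd : ∀ t ∈ Set.Ici (0 : ℝ), HasDerivWithinAt (fun t => V (x t) - D * t)
          (fderiv ℝ V (x t) (f (x t)) - D) (Set.Ici 0) t := fun t ht => by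
        have h1 := (h.differentiable (x t)).hasFDerivAt.comp_hasDerivWithinAt t (hx t ht)
        have h2 := ((hasDerivAt_id t).const_mul D).hasDerivWithinAt (s := Set.Ici 0)
        simpa using! h1.sub h2
      refine antitoneOn_of_hasDerivWithinAt_nonpos
        (f' := fun t => fderiv ℝ V (x t) (f (x t)) - D)
        (convex_Ici 0) (fun t ht => (hd t ht).continuousWithinAt)
        (fun t ht => (hd t (interior_subset ht)).mono interior_subset) (fun t ht => ?_)
      exact sub_nonpos.2 (hmax (hmem t (interior_subset ht)))
    have hT : 0 ≤ V (x 0) / -D := div_nonneg (h.nonneg _) (by linarith)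
    have := hanti2 Set.self_mem_Ici hT hT
    have h3 := hcon _ hT
    have h4 : D * (V (x 0) / -D) = - V (x 0) := by
      have hD0 := hneg.ne
      rw [div_neg, mul_neg, mul_div_assoc', mul_div_cancel_left₀ _ hD0]
    simp only [h4, mul_zero] at this
    linarith
  rw [Metric.tendsto_atTop]
  intro ε hε
  obtain ⟨m, hm, hball⟩ := h.exists_forall_lt hε
  obtain ⟨T, hT, hVT⟩ := hsmall m hm
  refine ⟨T, fun t ht => ?_⟩
  rw [dist_zero_right]
  exact hball _ ((hanti hT (hT.trans ht) ht).trans_lt hVT)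

/-- Cutting the field off outside a ball containing the sublevel set of `x₀` keeps `V`
nonincreasing, so the solution of the cut-off field never leaves the region where the two fields
agree. -/
theorem exists_isForwardSolution (h : IsLyapunovFunction f V) (hf : ContDiff ℝ 1 f)
    (x₀ : Euc n) : ∃ x : ℝ → Euc n, IsForwardSolution f x ∧ x 0 = x₀ := by
  obtain ⟨R, hR, hsub⟩ := (h.isCompact_sublevel (V x₀)).isBounded.subset_closedBall_lt 0 0
  let χ : ContDiffBump (0 : Euc n) := ⟨R, R + 1, hR, by linarith⟩
  have hcs : HasCompactSupport fun y => χ y • f y := χ.hasCompactSupport.smul_right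
  obtain ⟨x, hx, hx0⟩ := exists_isForwardSolution_of_hasCompactSupport
    (χ.contDiff.smul hf) hcs x₀
  refine ⟨x, fun t ht => ?_, hx0⟩
  have hle : V (x t) ≤ V x₀ := by
    have := hx.antitoneOn h.differentiable (fun y => by
      simpa using mul_nonpos_of_nonneg_of_nonpos (χ.nonneg (x := y)) (h.fderiv_apply_nonpos y))
      Set.self_mem_Ici ht ht
    simpa [hx0] using this
  have hone : χ (x t) = 1 := χ.one_of_mem_closedBall (hsub hle)
  simpa [hone] using hx t ht

/-- Lyapunov's theorem: a `C¹` vector field with a Lyapunov function is asymptotically stable. -/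
theorem asymptoticallyStable (h : IsLyapunovFunction f V) (hf : ContDiff ℝ 1 f) :
    AsymptoticallyStable f :=
  ⟨h.exists_isForwardSolution hf, h.lyapunovStable, fun _ hx => h.tendsto_zero hf.continuous hx⟩

end IsLyapunovFunction

/-! ### The rotated cubic field and its transcendental Lyapunov function -/

/-- First component of the gradient field `G` with `∇W = W / (u r) • G`, where `u = 2x² + y²`,
`r = x² + y²` and `W = u ^ lam * r`. -/
def gradX (lam x y : ℝ) : ℝ := 4 * lam * x * (x ^ 2 + y ^ 2) + 2 * x * (2 * x ^ 2 + y ^ 2)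

/-- Second component of the gradient field `G`; see `gradX`. -/
def gradY (lam x y : ℝ) : ℝ := 2 * lam * y * (x ^ 2 + y ^ 2) + 2 * y * (2 * x ^ 2 + y ^ 2)

theorem rotatedCubic_zero (lam θ : ℝ) (z : Euc 2) : rotatedCubic lam θ z 0 =
    -Real.cos θ * gradY lam (z 0) (z 1) - Real.sin θ * gradX lam (z 0) (z 1) := by
  simp [rotatedCubic, gradX, gradY]
  ring

theorem rotatedCubic_one (lam θ : ℝ) (z : Euc 2) : rotatedCubic lam θ z 1 =
    Real.cos θ * gradX lam (z 0) (z 1) - Real.sin θ * gradY lam (z 0) (z 1) := by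
  simp [rotatedCubic, gradX, gradY]
  ring

theorem contDiff_rotatedCubic (lam θ : ℝ) : ContDiff ℝ 1 (rotatedCubic lam θ) := by
  rw [contDiff_euclidean]
  intro i
  fin_cases i
  · simp only [Fin.zero_eta, rotatedCubic_zero, gradX, gradY]
    fun_prop
  · simp only [Fin.mk_one, rotatedCubic_one, gradX, gradY]
    fun_prop

/-- The power `(u ^ lam * r) ^ (j + 1)` of the first integral of `rotatedCubic lam 0`. -/
noncomputable def cubicLyapunov (lam : ℝ) (j : ℕ) (z : Euc 2) : ℝ :=
  (2 * z 0 ^ 2 + z 1 ^ 2) ^ ((j + 1) * lam) * (z 0 ^ 2 + z 1 ^ 2) ^ (j + 1)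

theorem Euc.norm_sq_two (z : Euc 2) : ‖z‖ ^ 2 = z 0 ^ 2 + z 1 ^ 2 := by
  simp [EuclideanSpace.norm_sq_eq, Fin.sum_univ_two]

theorem Euc.sq_add_sq_pos {z : Euc 2} (hz : z ≠ 0) : 0 < z 0 ^ 2 + z 1 ^ 2 := by
  rw [← Euc.norm_sq_two]
  positivity

/-- The base `u` vanishes at the origin, so the real power needs exponent at least `1`; this is why
`W` is raised to the power `j + 1`. -/
theorem contDiff_cubicLyapunov {lam : ℝ} {j : ℕ} (hj : 1 ≤ (j + 1) * lam) :
    ContDiff ℝ 1 (cubicLyapunov lam j) := by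
  unfold cubicLyapunov
  refine ContDiff.mul (ContDiff.rpow_const_of_le (by fun_prop) (by exact_mod_cast hj))
    (by fun_prop)

theorem fderiv_cubicLyapunov_apply {lam : ℝ} {j : ℕ} (hj : 1 ≤ (j + 1) * lam) (z v : Euc 2) :
    fderiv ℝ (cubicLyapunov lam j) z v =
      (j + 1) * (2 * z 0 ^ 2 + z 1 ^ 2) ^ ((j + 1) * lam - 1) * (z 0 ^ 2 + z 1 ^ 2) ^ j *
        (gradX lam (z 0) (z 1) * v 0 + gradY lam (z 0) (z 1) * v 1) := by
  have hdiff := (contDiff_cubicLyapunov hj).differentiable one_ne_zero z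
  rw [← hdiff.lineDeriv_eq_fderiv]
  have h0 : HasDerivAt (fun t : ℝ => (z + t • v) 0) (v 0) 0 := by
    simpa using ((hasDerivAt_id (0 : ℝ)).mul_const (v 0)).const_add (z 0)
  have h1 : HasDerivAt (fun t : ℝ => (z + t • v) 1) (v 1) 0 := by
    simpa using ((hasDerivAt_id (0 : ℝ)).mul_const (v 1)).const_add (z 1)
  have hu := ((h0.pow 2).const_mul 2).add (h1.pow 2)
  have hr := ((h0.pow 2).add (h1.pow 2)).pow (j + 1)
  have key := (hu.rpow_const (p := (j + 1) * lam) (Or.inr hj)).mul hr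
  refine HasDerivAt.deriv (key.congr_deriv ?_)
  simp only [zero_smul, add_zero, Pi.add_apply, Pi.pow_apply]
  have hsplit : (2 * z 0 ^ 2 + z 1 ^ 2) ^ ((j + 1) * lam) =
      (2 * z 0 ^ 2 + z 1 ^ 2) ^ ((j + 1) * lam - 1) * (2 * z 0 ^ 2 + z 1 ^ 2) := by
    rcases eq_or_lt_of_le (by positivity : 0 ≤ 2 * z 0 ^ 2 + z 1 ^ 2) with h | h
    · rw [← h, Real.zero_rpow (by linarith), mul_zero]
    · rw [← Real.rpow_add_one h.ne', sub_add_cancel]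
  rw [hsplit]
  simp only [gradX, gradY, Nat.add_sub_cancel, pow_succ, Nat.cast_add, Nat.cast_one]
  push_cast
  ring

theorem isLyapunovFunction_cubicLyapunov {lam θ : ℝ} {j : ℕ} (hlam : 0 < lam)
    (hj : 1 ≤ (j + 1) * lam) (hθ : 0 < θ) (hθ' : θ < Real.pi) :
    IsLyapunovFunction (rotatedCubic lam θ) (cubicLyapunov lam j) where
  contDiff := contDiff_cubicLyapunov hj
  radiallyUnbounded := by
    have hbound : ∀ᶠ z : Euc 2 in Bornology.cobounded (Euc 2), ‖z‖ ≤ cubicLyapunov lam j z := by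
      filter_upwards [tendsto_norm_cobounded_atTop.eventually_ge_atTop 1] with z hz
      have hr : 1 ≤ ‖z‖ ^ 2 := one_le_pow₀ hz
      have hr' := Euc.norm_sq_two z
      have h1 : 1 ≤ (2 * z 0 ^ 2 + z 1 ^ 2) ^ ((j + 1) * lam) :=
        Real.one_le_rpow (by nlinarith [sq_nonneg (z 0)]) (by positivity)
      have h2 : ‖z‖ ≤ (z 0 ^ 2 + z 1 ^ 2) ^ (j + 1) := by
        rw [← hr', ← pow_mul]
        exact le_self_pow₀ hz (by positivity)
      calc ‖z‖ = 1 * ‖z‖ := (one_mul _).symm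
        _ ≤ _ := mul_le_mul h1 h2 (norm_nonneg _) (by positivity)
    exact tendsto_atTop_mono' _ hbound tendsto_norm_cobounded_atTop
  zero := by simp [cubicLyapunov]
  pos z hz := by
    have hr := Euc.sq_add_sq_pos hz
    have hu : 0 < 2 * z 0 ^ 2 + z 1 ^ 2 := by nlinarith [sq_nonneg (z 0)]
    unfold cubicLyapunov
    positivity
  decreasing z hz := by
    have hr := Euc.sq_add_sq_pos hz
    have hu : 0 < 2 * z 0 ^ 2 + z 1 ^ 2 := by nlinarith [sq_nonneg (z 0)]
    have hsin := Real.sin_pos_of_pos_of_lt_pi hθ hθ'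
    rw [inner_gradient_left, fderiv_cubicLyapunov_apply hj, rotatedCubic_zero, rotatedCubic_one]
    have hG : 0 < gradX lam (z 0) (z 1) ^ 2 + gradY lam (z 0) (z 1) ^ 2 := by
      have hx : gradX lam (z 0) (z 1) = z 0 * (4 * lam * (z 0 ^ 2 + z 1 ^ 2) +
          2 * (2 * z 0 ^ 2 + z 1 ^ 2)) := by unfold gradX; ring
      have hy : gradY lam (z 0) (z 1) = z 1 * (2 * lam * (z 0 ^ 2 + z 1 ^ 2) +
          2 * (2 * z 0 ^ 2 + z 1 ^ 2)) := by unfold gradY; ring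
      rcases eq_or_ne (z 0) 0 with h0 | h0
      · have h1 : z 1 ≠ 0 := by
          rintro h1
          simp [h0, h1] at hr
        have : gradY lam (z 0) (z 1) ≠ 0 := by
          rw [hy]; exact mul_ne_zero h1 (by positivity)
        positivity
      · have : gradX lam (z 0) (z 1) ≠ 0 := by
          rw [hx]; exact mul_ne_zero h0 (by positivity)
        positivity
    have hfac : 0 < (j + 1 : ℝ) * (2 * z 0 ^ 2 + z 1 ^ 2) ^ ((j + 1) * lam - 1) *
        (z 0 ^ 2 + z 1 ^ 2) ^ j := by positivity
    have := mul_pos (mul_pos hfac hsin) hG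
    -- The `cos θ` terms cancel because they are orthogonal to `G`; what is left is `sin θ` times
    -- the squared norm of `G`.
    linear_combination (exp := 1) this

theorem asymptoticallyStable_rotatedCubic {lam θ : ℝ} (hlam : 0 < lam) (hθ : 0 < θ)
    (hθ' : θ < Real.pi) : AsymptoticallyStable (rotatedCubic lam θ) := by
  obtain ⟨j, hj⟩ := exists_nat_gt lam⁻¹
  have hj1 : 1 ≤ (j + 1) * lam := by
    have := (inv_lt_iff_one_lt_mul₀ hlam).1 hj
    nlinarith
  exact (isLyapunovFunction_cubicLyapunov hlam hj1 hθ hθ').asymptoticallyStable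
    (contDiff_rotatedCubic lam θ)

/-! ### Rational functions of one variable: residues and rigidity -/

namespace Polynomial

/-- If `P / Q` solves the logarithmic differential equation `v' / v = B / A`, then the order of
vanishing of `P / Q` at a simple root of `A` is the residue of `B / A`. -/
theorem eval_mul_rootMultiplicity_sub {K : Type*} [Field K] {A B A₁ P Q : K[X]} {z : K}
    (hA : A = (X - C z) * A₁) (hP : P ≠ 0) (hQ : Q ≠ 0)
    (h : A * (derivative P * Q - P * derivative Q) = B * (P * Q)) :
    A₁.eval z * ((P.rootMultiplicity z : K) - Q.rootMultiplicity z) = B.eval z := by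
  obtain ⟨P₁, hP₁, hPd⟩ := exists_eq_pow_rootMultiplicity_mul_and_not_dvd P hP z
  obtain ⟨Q₁, hQ₁, hQd⟩ := exists_eq_pow_rootMultiplicity_mul_and_not_dvd Q hQ z
  rw [dvd_iff_isRoot] at hPd hQd
  set m := P.rootMultiplicity z
  set n := Q.rootMultiplicity z
  -- The extra factor `X - C z` avoids the exponent `j - 1`, so `j = 0` needs no separate formula.
  have hder : ∀ (j : ℕ) (R : K[X]), (X - C z) * derivative ((X - C z) ^ j * R) =
      (X - C z) ^ j * (C (j : K) * R + (X - C z) * derivative R) := by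
    intro j R
    rw [derivative_mul, derivative_X_sub_C_pow]
    rcases j with _ | j
    · simp
    · simp only [Nat.add_sub_cancel]; ring
  have hne : (X - C z) ^ (m + n) ≠ 0 := pow_ne_zero _ (X_sub_C_ne_zero z)
  have hred : A₁ * ((C (m : K) * P₁ + (X - C z) * derivative P₁) * Q₁ -
      P₁ * (C (n : K) * Q₁ + (X - C z) * derivative Q₁)) = B * (P₁ * Q₁) := by
    refine mul_left_cancel₀ hne ?_
    have h1 := hder m P₁
    have h2 := hder n Q₁
    rw [← hP₁] at h1
    rw [← hQ₁] at h2
    rw [hA] at h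
    calc _ = A₁ * (((X - C z) ^ m * (C (m : K) * P₁ + (X - C z) * derivative P₁)) *
              ((X - C z) ^ n * Q₁) - ((X - C z) ^ m * P₁) *
              ((X - C z) ^ n * (C (n : K) * Q₁ + (X - C z) * derivative Q₁))) := by ring
      _ = (X - C z) * A₁ * (derivative P * Q - P * derivative Q) := by
          rw [← h1, ← h2, ← hP₁, ← hQ₁]; ring
      _ = B * (((X - C z) ^ m * P₁) * ((X - C z) ^ n * Q₁)) := by rw [h, ← hP₁, ← hQ₁]
      _ = _ := by ring
  have hev := congrArg (eval z) hred
  simp only [eval_mul, eval_sub, eval_add, eval_C, eval_X, sub_self, zero_mul, add_zero] at hev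
  have hPz : P₁.eval z ≠ 0 := hPd
  have hQz : Q₁.eval z ≠ 0 := hQd
  refine mul_right_cancel₀ (mul_ne_zero hPz hQz) ?_
  rw [← hev]
  ring

/-- The leading coefficients of `P(t)` and `P(-t)` agree up to sign, and the square removes the
sign. -/
theorem tendsto_div_eval_neg_sq {P : ℝ[X]} (hP : P ≠ 0) :
    Tendsto (fun t => (P.eval t / P.eval (-t)) ^ 2) atTop (𝓝 1) := by
  have hdeg : P.degree = (P.comp (-X)).degree := by
    rw [degree_eq_natDegree hP, degree_eq_natDegree, natDegree_comp]
    · simp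
    · intro h
      exact hP (by simpa [comp_assoc] using congrArg (fun R => R.comp (-X)) h)
  have h := (div_tendsto_atTop_leadingCoeff_div_of_degree_eq P (P.comp (-X)) hdeg).pow 2
  have hlc : (P.leadingCoeff / (P.comp (-X)).leadingCoeff) ^ 2 = 1 := by
    have h0 := leadingCoeff_ne_zero.2 hP
    rw [comp_neg_X_leadingCoeff_eq, div_pow, mul_pow, ← pow_mul, mul_comm P.natDegree, pow_mul]
    simp [h0]
  rw [hlc] at h
  simpa using h

theorem eventually_eval_ne_zero {P : ℝ[X]} (hP : P ≠ 0) : ∀ᶠ t in atTop, P.eval t ≠ 0 :=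
  (eventually_atTop_not_isRoot P hP)

theorem eventually_eval_neg_ne_zero {P : ℝ[X]} (hP : P ≠ 0) : ∀ᶠ t in atTop, P.eval (-t) ≠ 0 := by
  have h : P.comp (-X) ≠ 0 := fun h =>
    hP (by simpa [comp_assoc] using congrArg (fun R => R.comp (-X)) h)
  simpa using eventually_eval_ne_zero h

/-- An inequality between continuous functions that holds off the zeros of a nonzero polynomial
holds everywhere. -/
theorem nonneg_of_forall_eval_ne_zero {g : ℝ[X]} (hg : g ≠ 0) {R : ℝ → ℝ} (hR : Continuous R)
    (h : ∀ t, g.eval t ≠ 0 → 0 ≤ R t) (t : ℝ) : 0 ≤ R t := by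
  have hd : Dense {t | g.eval t ≠ 0} := by
    have hfin : Set.Finite {t | g.IsRoot t} := finite_setOfPred_isRoot hg
    exact Set.Countable.dense_compl ℝ (Set.Finite.countable hfin)
  have hcl : IsClosed {t | 0 ≤ R t} := isClosed_le continuous_const hR
  exact (hcl.closure_subset_iff.2 h) (hd t)

end Polynomial

/-- A monotone function whose values at `t` and `-t` are asymptotically equal is constant. -/
theorem constant_of_monotone_of_tendsto {φ : ℝ → ℝ} (hmono : Monotone φ)
    (h : Tendsto (fun t => φ t - φ (-t)) atTop (𝓝 0)) (x y : ℝ) : φ x = φ y := by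
  have key : ∀ x y : ℝ, φ y ≤ φ x := by
    intro x y
    rw [← sub_nonpos]
    refine ge_of_tendsto h ?_
    filter_upwards [eventually_ge_atTop y, eventually_ge_atTop (-x)] with t hy hx
    exact sub_le_sub (hmono hy) (hmono (by linarith))
  exact le_antisymm (key y x) (key x y)

/-- Turns a ratio of quotients `A / B`, `A' / B'` tending to `1` into a difference tending to `0`
after applying `x ↦ x / (1 + x)`. -/
theorem abs_div_add_sub_div_add_le {A B A' B' : ℝ} (hA : 0 < A) (hB : 0 < B) (hA' : 0 < A')
    (hB' : 0 < B') :
    |A / (A + B) - A' / (A' + B')| ≤ |A * B' / (A' * B) - 1| := by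
  have h1 : A / (A + B) - A' / (A' + B') =
      (A * B' / (A' * B) - 1) * ((A' * B) / ((A + B) * (A' + B'))) := by
    field_simp
    ring
  rw [h1, abs_mul]
  refine mul_le_of_le_one_right (abs_nonneg _) ?_
  rw [abs_of_pos (by positivity), div_le_one (by positivity)]
  nlinarith [mul_pos hA hA', mul_pos hA hB', mul_pos hB hB']

open Polynomial in
/-- The differential inequality for `P / Q` along a path on which `E` is even forces equality. -/
theorem log_deriv_eq_of_le {P Q : ℝ[X]} (hPQ : IsCoprime P Q) (hP : P ≠ 0) (hQ : Q ≠ 0)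
    {E l : ℝ → ℝ} (hE : ∀ t, 0 < E t) (heven : ∀ t, E (-t) = E t)
    (hderiv : ∀ t, HasDerivAt E (E t * l t) t)
    (hpos : ∀ t, 0 ≤ P.eval t * Q.eval t)
    (hle : ∀ t, P.eval t * Q.eval t * l t ≤
      2 * ((derivative P).eval t * Q.eval t - P.eval t * (derivative Q).eval t)) (t : ℝ) :
    P.eval t * Q.eval t * (2 * ((derivative P).eval t * Q.eval t -
      P.eval t * (derivative Q).eval t) - P.eval t * Q.eval t * l t) = 0 := by
  have hD : ∀ t, 0 < P.eval t ^ 2 + Q.eval t ^ 2 * E t := by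
    intro t
    obtain ⟨a, b, hab⟩ := hPQ
    have h1 := congrArg (eval t) hab
    simp only [eval_add, eval_mul, eval_one] at h1
    have hEt := hE t
    by_cases hp : P.eval t = 0
    · have hq : Q.eval t ≠ 0 := by
        intro hq
        simp [hp, hq] at h1
      positivity
    · positivity
  -- This is `P² / (Q² E)` followed by `x ↦ x / (1 + x)`, which removes the poles at zeros of `Q`;
  -- coprimality keeps the denominator positive.
  set φ : ℝ → ℝ := fun t => P.eval t ^ 2 / (P.eval t ^ 2 + Q.eval t ^ 2 * E t) with hφ
  have hφd : ∀ t, HasDerivAt φ (E t * (P.eval t * Q.eval t * (2 * ((derivative P).eval t *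
      Q.eval t - P.eval t * (derivative Q).eval t) - P.eval t * Q.eval t * l t)) /
      (P.eval t ^ 2 + Q.eval t ^ 2 * E t) ^ 2) t := by
    intro t
    have hp := (P.hasDerivAt t).pow 2
    have hq := ((Q.hasDerivAt t).pow 2).mul (hderiv t)
    refine (hp.div (hp.add hq) (hD t).ne').congr_deriv ?_
    simp only [Pi.add_apply, Pi.pow_apply, Pi.mul_apply]
    congr 1
    push_cast
    ring
  have hmono : Monotone φ := by
    refine monotone_of_deriv_nonneg (fun t => (hφd t).differentiableAt) fun t => ?_
    rw [(hφd t).deriv]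
    exact div_nonneg (mul_nonneg (hE t).le (mul_nonneg (hpos t) (sub_nonneg.2 (hle t))))
      (sq_nonneg _)
  -- The lines of slope parameter `t` and `-t` approach the same axis as `t → ∞`: this closes up the
  -- orbit.
  have hlim : Tendsto (fun t => φ t - φ (-t)) atTop (𝓝 0) := by
    have hPt := tendsto_div_eval_neg_sq hP
    have hQt := (tendsto_div_eval_neg_sq hQ).inv₀ one_ne_zero
    have h1 : Tendsto (fun t => |(P.eval t / P.eval (-t)) ^ 2 *
        ((Q.eval t / Q.eval (-t)) ^ 2)⁻¹ - 1|) atTop (𝓝 0) := by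
      simpa using ((hPt.mul hQt).sub_const 1).abs
    rw [tendsto_zero_iff_abs_tendsto_zero]
    refine tendsto_of_tendsto_of_tendsto_of_le_of_le' tendsto_const_nhds h1
      (Eventually.of_forall fun t => abs_nonneg _) ?_
    filter_upwards [eventually_eval_ne_zero hP, eventually_eval_neg_ne_zero hP,
      eventually_eval_ne_zero hQ, eventually_eval_neg_ne_zero hQ] with t h1 h2 h3 h4
    have hEt := hE t
    have hle := abs_div_add_sub_div_add_le (A := P.eval t ^ 2) (B := Q.eval t ^ 2 * E t)
      (A' := P.eval (-t) ^ 2) (B' := Q.eval (-t) ^ 2 * E t) (by positivity) (by positivity)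
      (by positivity) (by positivity)
    have heq : P.eval t ^ 2 * (Q.eval (-t) ^ 2 * E t) / (P.eval (-t) ^ 2 * (Q.eval t ^ 2 * E t)) =
        (P.eval t / P.eval (-t)) ^ 2 * ((Q.eval t / Q.eval (-t)) ^ 2)⁻¹ := by
      field_simp
    rw [heq] at hle
    simpa only [hφ, Function.comp_apply, heven] using hle
  have hconst := constant_of_monotone_of_tendsto hmono hlim
  have hφc : φ = fun _ => φ 0 := funext fun s => hconst s 0
  have hzero : HasDerivAt φ 0 t := by
    rw [hφc]
    exact hasDerivAt_const t (φ 0)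
  have h0 := (hφd t).unique hzero
  rw [div_eq_zero_iff] at h0
  rcases h0 with h0 | h0
  · exact (mul_eq_zero.1 h0).resolve_left (hE t).ne'
  · exact absurd h0 (pow_ne_zero _ (hD t).ne')

open Polynomial in
/-- For irrational `lam`, the logarithmic differential equation satisfied by powers of
`(2 t² + 1) ^ lam * (t² + 1)` has no nonconstant rational solutions. -/
theorem false_of_log_deriv_eq {lam k : ℝ} (hlam : 0 < lam) (hirr : Irrational lam) (hk : 0 < k)
    {P Q : ℝ[X]} (hP : P ≠ 0) (hQ : Q ≠ 0)
    (h : C (2 * lam + 2) * ((2 * X ^ 2 + 1) * (X ^ 2 + 1)) *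
        (derivative P * Q - P * derivative Q) =
      C k * (C (4 * lam) * X * (X ^ 2 + 1) + 2 * X * (2 * X ^ 2 + 1)) * (P * Q)) : False := by
  have hP' : P.map Complex.ofRealHom ≠ 0 := (Polynomial.map_ne_zero_iff Complex.ofReal_injective).2 hP
  have hQ' : Q.map Complex.ofRealHom ≠ 0 := (Polynomial.map_ne_zero_iff Complex.ofReal_injective).2 hQ
  have hmap := congrArg (Polynomial.map Complex.ofRealHom) h
  simp only [Polynomial.map_mul, Polynomial.map_sub, Polynomial.map_add, Polynomial.map_pow,
    map_X, map_C, Polynomial.map_one, Polynomial.map_ofNat, ← derivative_map] at hmap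
  obtain ⟨z, hz⟩ := IsAlgClosed.exists_pow_nat_eq (-1 / 2 : ℂ) (n := 2) two_pos
  have hz' : 2 * z ^ 2 = -1 := by rw [hz]; ring
  have hz0 : z ≠ 0 := by
    rintro rfl
    norm_num at hz'
  have hI : (X : ℂ[X]) ^ 2 + 1 = (X - C Complex.I) * (X + C Complex.I) := by
    have : (C Complex.I : ℂ[X]) * C Complex.I = -1 := by
      rw [← C_mul, Complex.I_mul_I]; simp
    linear_combination this
  have hu : 2 * (X : ℂ[X]) ^ 2 + 1 = (X - C z) * (2 * (X + C z)) := by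
    have : (2 : ℂ[X]) * C z ^ 2 = -1 := by
      rw [← C_pow, show (2 : ℂ[X]) = C 2 from rfl, ← C_mul, hz']; simp
    linear_combination this
  -- The residues are `k / (2 lam + 2)` at the zero `I` of `r` and `k lam / (2 lam + 2)` at the zero
  -- `z` of `u`. Both are integers, the first nonzero, and their ratio is `lam`.
  have h1 := eval_mul_rootMultiplicity_sub (z := Complex.I)
    (A₁ := C (Complex.ofRealHom (2 * lam + 2)) * ((2 * X ^ 2 + 1) * (X + C Complex.I)))
    (by rw [hI]; ring) hP' hQ' hmap
  have h2 := eval_mul_rootMultiplicity_sub (z := z)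
    (A₁ := C (Complex.ofRealHom (2 * lam + 2)) * ((2 * (X + C z)) * (X ^ 2 + 1)))
    (by rw [hu]; ring) hP' hQ' hmap
  set m₁ := (P.map Complex.ofRealHom).rootMultiplicity Complex.I
  set n₁ := (Q.map Complex.ofRealHom).rootMultiplicity Complex.I
  set m₂ := (P.map Complex.ofRealHom).rootMultiplicity z
  set n₂ := (Q.map Complex.ofRealHom).rootMultiplicity z
  simp only [eval_mul, eval_add, eval_pow, eval_X, eval_C, eval_one, eval_ofNat,
    Complex.ofRealHom_eq_coe, Complex.I_sq] at h1 h2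
  have e1 : (2 * lam + 2) * ((m₁ : ℝ) - n₁) = k := by
    have : ((2 * lam + 2 : ℝ) : ℂ) * ((m₁ : ℂ) - n₁) = k := by
      refine mul_left_cancel₀ (mul_ne_zero two_ne_zero Complex.I_ne_zero) ?_
      linear_combination -h1
    exact_mod_cast this
  have e2 : (2 * lam + 2) * ((m₂ : ℝ) - n₂) = k * lam := by
    have : ((2 * lam + 2 : ℝ) : ℂ) * ((m₂ : ℂ) - n₂) = k * lam := by
      refine mul_left_cancel₀ (mul_ne_zero two_ne_zero hz0) ?_
      have hz2 : z ^ 2 = -1 / 2 := hz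
      rw [hz2] at h2
      push_cast at h2 ⊢
      linear_combination h2
    exact_mod_cast this
  have hd : (m₁ : ℝ) - n₁ ≠ 0 := by
    intro h0
    rw [h0, mul_zero] at e1
    exact hk.ne e1
  have hlam2 : 2 * lam + 2 ≠ 0 := by positivity
  have e3 : ((m₂ : ℝ) - n₂) = lam * ((m₁ : ℝ) - n₁) := by
    refine mul_left_cancel₀ hlam2 ?_
    rw [e2, ← e1]
    ring
  refine hirr ⟨((m₂ : ℚ) - n₂) / ((m₁ : ℚ) - n₁), ?_⟩
  push_cast
  rw [e3, mul_div_cancel_right₀ _ hd]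

theorem gradX_div_eq {lam t : ℝ} : gradX lam t 1 / ((2 * t ^ 2 + 1) * (t ^ 2 + 1)) =
    lam * (4 * t / (2 * t ^ 2 + 1)) + 2 * t / (t ^ 2 + 1) := by
  have h1 : (2 * t ^ 2 + 1) ≠ 0 := by positivity
  have h2 : (t ^ 2 + 1) ≠ 0 := by positivity
  unfold gradX
  field_simp

open Polynomial in
theorem false_of_coprime_of_le {lam k : ℝ} (hlam : 0 < lam) (hirr : Irrational lam) (hk : 0 < k)
    {P Q : ℝ[X]} (hPQ : IsCoprime P Q) (hP : P ≠ 0) (hQ : Q ≠ 0)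
    (hpos : ∀ t, 0 ≤ P.eval t * Q.eval t)
    (hle : ∀ t, k * (P.eval t * Q.eval t) * gradX lam t 1 ≤
      (2 * lam + 2) * ((2 * t ^ 2 + 1) * (t ^ 2 + 1)) *
        ((derivative P).eval t * Q.eval t - P.eval t * (derivative Q).eval t)) : False := by
  -- `E` is `W ^ (k / (lam + 1))` on the line `y = 1`. As `W` has degree `2 lam + 2`, this power has
  -- degree `2k`, matching the square of a function of degree `k`.
  have hE : ∀ t : ℝ, HasDerivAt (fun t : ℝ => Real.exp (k / (lam + 1) *
      (lam * Real.log (2 * t ^ 2 + 1) + Real.log (t ^ 2 + 1))))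
      (Real.exp (k / (lam + 1) * (lam * Real.log (2 * t ^ 2 + 1) + Real.log (t ^ 2 + 1))) *
        (k / (lam + 1) * (gradX lam t 1 / ((2 * t ^ 2 + 1) * (t ^ 2 + 1))))) t := by
    intro t
    have h1 : HasDerivAt (fun t : ℝ => 2 * t ^ 2 + 1) (4 * t) t :=
      (((hasDerivAt_pow 2 t).const_mul 2).add_const 1).congr_deriv (by push_cast; ring)
    have h2 : HasDerivAt (fun t : ℝ => t ^ 2 + 1) (2 * t) t :=
      ((hasDerivAt_pow 2 t).add_const 1).congr_deriv (by push_cast; ring)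
    rw [gradX_div_eq]
    exact ((((h1.log (by positivity)).const_mul lam).add (h2.log (by positivity))).const_mul _).exp
  have key := log_deriv_eq_of_le hPQ hP hQ (fun t => Real.exp_pos _) (fun t => by simp) hE hpos
    (fun t => by
      have hu : 0 < (2 * t ^ 2 + 1) * (t ^ 2 + 1) := by positivity
      rw [div_mul_div_comm, mul_div_assoc', div_le_iff₀ (by positivity)]
      linear_combination hle t)
  refine false_of_log_deriv_eq hlam hirr hk hP hQ ?_
  refine mul_left_cancel₀ (mul_ne_zero hP hQ) (Polynomial.funext fun t => ?_)
  have hu : (2 * t ^ 2 + 1) * (t ^ 2 + 1) ≠ 0 := by positivity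
  have hl : lam + 1 ≠ 0 := by positivity
  have hk := key t
  rw [div_mul_div_comm, mul_div_assoc', mul_sub, mul_div_assoc', sub_eq_zero,
    eq_div_iff (mul_ne_zero hl hu)] at hk
  simp only [eval_mul, eval_add, eval_sub, eval_pow, eval_X, eval_C, eval_one, eval_ofNat]
  unfold gradX at hk
  linear_combination hk

open Polynomial in
-- Dividing out the gcd `g` scales both inequalities by `g²`, since the Wronskian of `g P₁`, `g Q₁`
-- is `g²` times that of `P₁`, `Q₁`. Zeros of `g` are recovered by density.
theorem false_of_nonneg_of_le {lam k : ℝ} (hlam : 0 < lam) (hirr : Irrational lam) (hk : 0 < k)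
    {P Q : ℝ[X]} (hP : P ≠ 0) (hQ : Q ≠ 0)
    (hpos : ∀ t, 0 ≤ P.eval t * Q.eval t)
    (hle : ∀ t, k * (P.eval t * Q.eval t) * gradX lam t 1 ≤
      (2 * lam + 2) * ((2 * t ^ 2 + 1) * (t ^ 2 + 1)) *
        ((derivative P).eval t * Q.eval t - P.eval t * (derivative Q).eval t)) : False := by
  obtain ⟨g, P₁, Q₁, hg, hcop, rfl, rfl⟩ : ∃ g P₁ Q₁ : ℝ[X], g ≠ 0 ∧ IsCoprime P₁ Q₁ ∧
      P = g * P₁ ∧ Q = g * Q₁ :=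
    ⟨gcd P Q, P / gcd P Q, Q / gcd P Q, gcd_ne_zero_of_right hQ, isCoprime_div_gcd_div_gcd hQ,
      (EuclideanDomain.mul_div_cancel' (gcd_ne_zero_of_right hQ) (gcd_dvd_left _ _)).symm,
      (EuclideanDomain.mul_div_cancel' (gcd_ne_zero_of_right hQ) (gcd_dvd_right _ _)).symm⟩
  refine false_of_coprime_of_le hlam hirr hk hcop (right_ne_zero_of_mul hP)
    (right_ne_zero_of_mul hQ) (fun t => ?_) (fun t => ?_)
  · have := nonneg_of_forall_eval_ne_zero hg (P₁ * Q₁).continuous (fun t ht => ?_) t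
    · simpa using this
    · have h1 := hpos t
      simp only [eval_mul] at h1 ⊢
      have h2 : 0 < g.eval t ^ 2 := by positivity
      refine le_of_mul_le_mul_left ?_ h2
      linear_combination h1
  · have := nonneg_of_forall_eval_ne_zero hg (C (2 * lam + 2) * ((2 * X ^ 2 + 1) * (X ^ 2 + 1)) *
        (derivative P₁ * Q₁ - P₁ * derivative Q₁) -
      C k * (C (4 * lam) * X * (X ^ 2 + 1) + 2 * X * (2 * X ^ 2 + 1)) * (P₁ * Q₁)).continuous
      (fun t ht => ?_) t
    · simp only [eval_mul, eval_add, eval_sub, eval_pow, eval_X, eval_C, eval_one,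
        eval_ofNat] at this
      unfold gradX
      linear_combination this
    · have h1 := hle t
      simp only [derivative_mul, eval_mul, eval_add, eval_sub, eval_pow, eval_X, eval_C, eval_one,
        eval_ofNat] at h1 ⊢
      have h2 : 0 < g.eval t ^ 2 := by positivity
      refine le_of_mul_le_mul_left ?_ h2
      unfold gradX at h1
      linear_combination h1

/-! ### Dehomogenization and the inequality on the line `y = 1` -/

theorem MvPolynomial.IsHomogeneous.eval_mul_left {σ R : Type*} [Fintype σ] [CommSemiring R]
    {p : MvPolynomial σ R} {a : ℕ} (hp : p.IsHomogeneous a) (r : R) (x : σ → R) :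
    MvPolynomial.eval (fun i => r * x i) p = r ^ a * MvPolynomial.eval x p := by
  rw [MvPolynomial.eval_eq', MvPolynomial.eval_eq', Finset.mul_sum]
  refine Finset.sum_congr rfl fun d hd => ?_
  have hdeg : ∑ i, d i = a := by
    have h := hp (MvPolynomial.mem_support_iff.1 hd)
    change Finsupp.weight (fun _ => 1) d = a at h
    rwa [← Finsupp.degree_eq_weight_one, Finsupp.degree_eq_sum] at h
  simp_rw [mul_pow]
  rw [Finset.prod_mul_distrib, Finset.prod_pow_eq_pow_sum, hdeg]
  ring

/-- The dehomogenization `p(X, 1)` of a bivariate polynomial. -/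
noncomputable def dehomogenize (p : MvPolynomial (Fin 2) ℝ) : Polynomial ℝ :=
  MvPolynomial.aeval ![Polynomial.X, 1] p

theorem eval_dehomogenize (p : MvPolynomial (Fin 2) ℝ) (t : ℝ) :
    (dehomogenize p).eval t = MvPolynomial.eval ![t, 1] p := by
  have h : (Polynomial.aeval t).comp (MvPolynomial.aeval ![Polynomial.X, 1]) =
      (MvPolynomial.aeval ![t, 1] : MvPolynomial (Fin 2) ℝ →ₐ[ℝ] ℝ) := by
    ext i
    fin_cases i <;> simp
  have h2 := DFunLike.congr_fun h p
  simpa [dehomogenize, MvPolynomial.aeval_eq_eval, Polynomial.aeval_def] using h2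

theorem natDegree_dehomogenize_le {p : MvPolynomial (Fin 2) ℝ} {a : ℕ} (hp : p.IsHomogeneous a) :
    (dehomogenize p).natDegree ≤ a := by
  have h := MvPolynomial.aeval_natDegree_le p hp.totalDegree_le ![Polynomial.X, 1] (n := 1)
    (by intro i; fin_cases i <;> simp)
  simpa [dehomogenize] using h

theorem eval_eq_pow_mul_eval_dehomogenize {p : MvPolynomial (Fin 2) ℝ} {a : ℕ}
    (hp : p.IsHomogeneous a) (z : Fin 2 → ℝ) (hz : z 1 ≠ 0) :
    MvPolynomial.eval z p = z 1 ^ a * (dehomogenize p).eval (z 0 / z 1) := by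
  rw [eval_dehomogenize, ← hp.eval_mul_left]
  congr 2
  ext i
  fin_cases i
  · simp [mul_div_cancel₀ _ hz]
  · simp

theorem dehomogenize_ne_zero {p : MvPolynomial (Fin 2) ℝ} {a : ℕ} (hp : p.IsHomogeneous a)
    (h0 : p ≠ 0) : dehomogenize p ≠ 0 := by
  intro h
  -- The factor `X 1` takes care of the points with `z 1 = 0`, which dehomogenization does not see.
  refine mul_ne_zero h0 (MvPolynomial.X_ne_zero (R := ℝ) (1 : Fin 2)) (MvPolynomial.funext fun z => ?_)
  rcases eq_or_ne (z 1) 0 with hz | hz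
  · simp [hz]
  · simp [eval_eq_pow_mul_eval_dehomogenize hp z hz, h]

/-- A rational Lyapunov function with homogeneous numerator and denominator has numerator of larger
degree than the denominator. -/
theorem IsLyapunovFunction.degree_lt {f : Euc 2 → Euc 2} {V : Euc 2 → ℝ}
    (hV : IsLyapunovFunction f V) {p q : MvPolynomial (Fin 2) ℝ} {a b : ℕ}
    (hp : p.IsHomogeneous a) (hq : q.IsHomogeneous b) {z : Euc 2} (hz : z ≠ 0)
    (hqz : MvPolynomial.eval (fun i => z i) q ≠ 0)
    (hVpq : ∀ x : Euc 2, MvPolynomial.eval (fun i => x i) q ≠ 0 →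
        V x = MvPolynomial.eval (fun i => x i) p / MvPolynomial.eval (fun i => x i) q) :
    b < a := by
  by_contra! hab
  have htend : Tendsto (fun r : ℝ => r • z) atTop (Bornology.cobounded (Euc 2)) := by
    rw [← tendsto_norm_atTop_iff_cobounded]
    simp_rw [norm_smul]
    exact (tendsto_norm_atTop_atTop).atTop_mul_const (norm_pos_iff.2 hz)
  have hlarge := (hV.radiallyUnbounded.comp htend).eventually_gt_atTop (V z)
  obtain ⟨r, hr, hr1⟩ := (hlarge.and (eventually_ge_atTop 1)).exists
  have hr0 : 0 < r := by linarith
  have e1 := hp.eval_mul_left r (fun i => z i)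
  have e2 := hq.eval_mul_left r (fun i => z i)
  have hne : MvPolynomial.eval (fun i => (r • z) i) q ≠ 0 := by
    simp only [PiLp.smul_apply, smul_eq_mul, e2]
    exact mul_ne_zero (pow_ne_zero _ hr0.ne') hqz
  simp only [Function.comp_apply] at hr
  rw [hVpq _ hne] at hr
  simp only [PiLp.smul_apply, smul_eq_mul, e1, e2] at hr
  rw [mul_div_mul_comm, ← hVpq z hqz] at hr
  have : r ^ a / r ^ b ≤ 1 := div_le_one_of_le₀ (pow_le_pow_right₀ hr1 hab) (by positivity)
  nlinarith [hV.pos z hz]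

/-- The derivative of `p / q` at `(t, 1)` along `v` in terms of the dehomogenizations. -/
theorem fderiv_apply_of_eq_div {V : Euc 2 → ℝ} {p q : MvPolynomial (Fin 2) ℝ} {a b : ℕ}
    (hp : p.IsHomogeneous a) (hq : q.IsHomogeneous b)
    (hVpq : ∀ x : Euc 2, MvPolynomial.eval (fun i => x i) q ≠ 0 →
        V x = MvPolynomial.eval (fun i => x i) p / MvPolynomial.eval (fun i => x i) q)
    {z : Euc 2} (hz : z 1 = 1) (hV : DifferentiableAt ℝ V z)
    (hQ : (dehomogenize q).eval (z 0) ≠ 0) (v : Euc 2) :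
    fderiv ℝ V z v * (dehomogenize q).eval (z 0) ^ 2 =
      ((Polynomial.derivative (dehomogenize p)).eval (z 0) * (dehomogenize q).eval (z 0) -
        (dehomogenize p).eval (z 0) * (Polynomial.derivative (dehomogenize q)).eval (z 0)) *
        (v 0 - z 0 * v 1) +
      ((a : ℝ) - b) * ((dehomogenize p).eval (z 0) * (dehomogenize q).eval (z 0)) * v 1 := by
  set P := dehomogenize p
  set Q := dehomogenize q
  have h0 : HasDerivAt (fun s : ℝ => z 0 + s * v 0) (v 0) 0 := by
    simpa using ((hasDerivAt_id (0 : ℝ)).mul_const (v 0)).const_add (z 0)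
  have h1 : HasDerivAt (fun s : ℝ => 1 + s * v 1) (v 1) 0 := by
    simpa using ((hasDerivAt_id (0 : ℝ)).mul_const (v 1)).const_add 1
  have hτ : HasDerivAt (fun s : ℝ => (z 0 + s * v 0) / (1 + s * v 1)) (v 0 - z 0 * v 1) 0 := by
    simpa using! h0.div h1 (by simp)
  have hP : HasDerivAt (fun s : ℝ => P.eval ((z 0 + s * v 0) / (1 + s * v 1)))
      ((Polynomial.derivative P).eval (z 0) * (v 0 - z 0 * v 1)) 0 :=
    HasDerivAt.comp (h₂ := fun x => P.eval x) 0 (by simpa using P.hasDerivAt (z 0)) hτ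
  have hQd : HasDerivAt (fun s : ℝ => Q.eval ((z 0 + s * v 0) / (1 + s * v 1)))
      ((Polynomial.derivative Q).eval (z 0) * (v 0 - z 0 * v 1)) 0 :=
    HasDerivAt.comp (h₂ := fun x => Q.eval x) 0 (by simpa using Q.hasDerivAt (z 0)) hτ
  have hnum := (h1.pow a).mul hP
  have hden := (h1.pow b).mul hQd
  have hquot := hnum.div hden (by simpa using hQ)
  have hline : HasDerivAt (fun s : ℝ => V (z + s • v)) (fderiv ℝ V z v) 0 :=
    hV.hasFDerivAt.hasLineDerivAt v
  have hev : (fun s : ℝ => V (z + s • v)) =ᶠ[𝓝 0] (fun s : ℝ =>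
      ((1 + s * v 1) ^ a * P.eval ((z 0 + s * v 0) / (1 + s * v 1))) /
      ((1 + s * v 1) ^ b * Q.eval ((z 0 + s * v 0) / (1 + s * v 1)))) := by
    filter_upwards [h1.continuousAt.eventually_ne (y := 0) (by simp),
      hQd.continuousAt.eventually_ne (y := 0) (by simpa using hQ)] with s hs1 hs2
    have hc0 : (z + s • v) 0 = z 0 + s * v 0 := by simp
    have hc1 : (z + s • v) 1 = 1 + s * v 1 := by simp [hz]
    have hne : (z + s • v) 1 ≠ 0 := by rwa [hc1]
    have ep := eval_eq_pow_mul_eval_dehomogenize hp (fun i => (z + s • v) i) hne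
    have eq := eval_eq_pow_mul_eval_dehomogenize hq (fun i => (z + s • v) i) hne
    rw [hc0, hc1] at ep eq
    rw [hVpq _ (by rw [eq]; exact mul_ne_zero (pow_ne_zero _ hs1) hs2), ep, eq]
  have hd := hline.unique (hquot.congr_of_eventuallyEq hev)
  rw [hd]
  simp only [Pi.mul_apply, Pi.pow_apply, zero_mul, add_zero, one_pow, div_one, one_mul, mul_one]
  rw [div_mul_cancel₀ _ (pow_ne_zero _ hQ)]
  ring

/-- The values of `rotatedCubic lam θ` at `(t, 1)` determine a polynomial inequality for the
dehomogenized numerator and denominator of a rational Lyapunov function. -/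
theorem exists_polynomial_of_hasRationalLyapunov {lam θ : ℝ} {s : ℕ}
    (h : HasRationalLyapunov (rotatedCubic lam θ) s) :
    ∃ (k : ℝ) (P Q : Polynomial ℝ), k ∈ Set.Icc (1 : ℝ) s ∧ P ≠ 0 ∧ Q ≠ 0 ∧
      P.natDegree ≤ s ∧ Q.natDegree ≤ s ∧ ∀ t, Q.eval t ≠ 0 →
        0 ≤ P.eval t * Q.eval t ∧
        ((Polynomial.derivative P).eval t * Q.eval t - P.eval t * (Polynomial.derivative Q).eval t) *
          (rotatedCubic lam θ !₂[t, 1] 0 - t * rotatedCubic lam θ !₂[t, 1] 1) +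
        k * (P.eval t * Q.eval t) * rotatedCubic lam θ !₂[t, 1] 1 ≤ 0 := by
  obtain ⟨p, q, ⟨a, ha, hp⟩, ⟨b, hq⟩, hq0, V, hV, hVpq⟩ := h
  have hQ0 := dehomogenize_ne_zero hq hq0
  obtain ⟨t₀, ht₀⟩ : ∃ t, (dehomogenize q).eval t ≠ 0 := by
    by_contra! hcon
    exact hQ0 (Polynomial.funext fun t => by simpa using hcon t)
  have hne : ∀ t : ℝ, (!₂[t, 1] : Euc 2) ≠ 0 := fun t h => by
    simpa using congrArg (fun x : Euc 2 => x 1) h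
  have hfun : ∀ t : ℝ, (fun i => (!₂[t, 1] : Euc 2) i) = ![t, 1] := fun t => rfl
  have hval : ∀ t : ℝ, (dehomogenize q).eval t ≠ 0 →
      V !₂[t, 1] = (dehomogenize p).eval t / (dehomogenize q).eval t := fun t ht => by
    rw [eval_dehomogenize] at ht
    rw [hVpq _ (by rwa [hfun]), hfun, eval_dehomogenize, eval_dehomogenize]
  -- This confines `k = a - b` to `[1, s]`, away from `0`, and also bounds the degree of `q`, on
  -- which nothing was assumed.
  have hba : b < a := hV.degree_lt hp hq (hne t₀)
    (by rwa [hfun, ← eval_dehomogenize]) hVpq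
  refine ⟨(a : ℝ) - b, dehomogenize p, dehomogenize q, ⟨?_, ?_⟩, ?_, hQ0,
    (natDegree_dehomogenize_le hp).trans ha,
    (natDegree_dehomogenize_le hq).trans (hba.le.trans ha), fun t ht => ⟨?_, ?_⟩⟩
  · have : (b : ℝ) + 1 ≤ a := by exact_mod_cast hba
    linarith
  · have : (a : ℝ) ≤ s := by exact_mod_cast ha
    linarith [(Nat.cast_nonneg b : (0 : ℝ) ≤ b)]
  · intro hP0
    have := hV.pos _ (hne t₀)
    rw [hval t₀ ht₀, hP0] at this
    simp at this
  · have := (hV.pos _ (hne t)).le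
    rw [hval t ht] at this
    have h2 := mul_nonneg this (sq_nonneg ((dehomogenize q).eval t))
    rwa [sq, ← mul_assoc, div_mul_cancel₀ _ ht] at h2
  · have := fderiv_apply_of_eq_div hp hq hVpq (z := !₂[t, 1]) (by simp)
      (hV.differentiable _) (by simpa using ht) (rotatedCubic lam θ !₂[t, 1])
    have hneg := mul_nonpos_of_nonpos_of_nonneg (hV.fderiv_apply_neg (hne t)).le
      (sq_nonneg ((dehomogenize q).eval t))
    simp only [Matrix.cons_val_zero] at this
    rwa [this] at hneg

theorem rotatedCubic_zero_at (lam θ t : ℝ) : rotatedCubic lam θ !₂[t, 1] 0 =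
    -Real.cos θ * gradY lam t 1 - Real.sin θ * gradX lam t 1 := by
  simp [rotatedCubic_zero]

theorem rotatedCubic_one_at (lam θ t : ℝ) : rotatedCubic lam θ !₂[t, 1] 1 =
    Real.cos θ * gradX lam t 1 - Real.sin θ * gradY lam t 1 := by
  simp [rotatedCubic_one]

/-! ### Compactness in the coefficients as `θ → 0` -/

/-- A nonzero polynomial of degree at most `s` is a positive multiple of one whose coefficient
vector has norm one. -/
theorem Polynomial.exists_smul_ofFn_eq {P : Polynomial ℝ} (hP : P ≠ 0) {s : ℕ}
    (hs : P.natDegree ≤ s) :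
    ∃ (α : ℝ) (c : Fin (s + 1) → ℝ), 0 < α ∧ ‖c‖ = 1 ∧ P = α • Polynomial.ofFn (s + 1) c := by
  have hv := Polynomial.ofFn_comp_toFn_eq_id_of_natDegree_lt (Nat.lt_succ_of_le hs)
  set v := Polynomial.toFn (s + 1) P
  have hv0 : v ≠ 0 := by
    intro h0
    rw [h0, map_zero] at hv
    exact hP hv.symm
  have hn : 0 < ‖v‖ := norm_pos_iff.2 hv0
  refine ⟨‖v‖, ‖v‖⁻¹ • v, hn, ?_, ?_⟩
  · rw [norm_smul, norm_inv, norm_norm, inv_mul_cancel₀ hn.ne']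
  · rw [map_smul, smul_inv_smul₀ hn.ne', hv]

theorem Polynomial.continuous_eval_ofFn (n : ℕ) (t : ℝ) :
    Continuous fun c : Fin n → ℝ => (Polynomial.ofFn n c).eval t :=
  ((Polynomial.leval t).comp (Polynomial.ofFn n)).continuous_of_finiteDimensional

theorem Polynomial.continuous_eval_derivative_ofFn (n : ℕ) (t : ℝ) :
    Continuous fun c : Fin n → ℝ => (Polynomial.derivative (Polynomial.ofFn n c)).eval t :=
  ((Polynomial.leval t).comp
    (Polynomial.derivative.comp (Polynomial.ofFn n))).continuous_of_finiteDimensional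

/-- The expression `Q² ⟨∇(P / Q), f⟩` at `(t, 1)` for `f = rotatedCubic lam θ`, where `P` and `Q` are
given by coefficient vectors and `P / Q` stands for a homogeneous function of degree `k`. -/
noncomputable def lieNumerator (lam : ℝ) {n : ℕ} (t : ℝ)
    (w : ℝ × ℝ × (Fin n → ℝ) × (Fin n → ℝ)) : ℝ :=
  ((Polynomial.derivative (Polynomial.ofFn n w.2.2.1)).eval t * (Polynomial.ofFn n w.2.2.2).eval t -
    (Polynomial.ofFn n w.2.2.1).eval t * (Polynomial.derivative (Polynomial.ofFn n w.2.2.2)).eval t) *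
      (rotatedCubic lam w.1 !₂[t, 1] 0 - t * rotatedCubic lam w.1 !₂[t, 1] 1) +
    w.2.1 * ((Polynomial.ofFn n w.2.2.1).eval t * (Polynomial.ofFn n w.2.2.2).eval t) *
      rotatedCubic lam w.1 !₂[t, 1] 1

theorem continuous_lieNumerator (lam : ℝ) {n : ℕ} (t : ℝ) :
    Continuous (lieNumerator lam (n := n) t) := by
  have h1 := Polynomial.continuous_eval_ofFn n t
  have h2 := Polynomial.continuous_eval_derivative_ofFn n t
  have hp : Continuous fun w : ℝ × ℝ × (Fin n → ℝ) × (Fin n → ℝ) => w.2.2.1 := by fun_prop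
  have hq : Continuous fun w : ℝ × ℝ × (Fin n → ℝ) × (Fin n → ℝ) => w.2.2.2 := by fun_prop
  have hθ : ∀ i, Continuous fun w : ℝ × ℝ × (Fin n → ℝ) × (Fin n → ℝ) =>
      rotatedCubic lam w.1 !₂[t, 1] i := by
    intro i
    fin_cases i
    · simp only [Fin.zero_eta, rotatedCubic_zero_at]
      fun_prop
    · simp only [Fin.mk_one, rotatedCubic_one_at]
      fun_prop
  exact ((((h2.comp hp).mul (h1.comp hq)).sub ((h1.comp hp).mul (h2.comp hq))).mul
    ((hθ 0).sub (continuous_const.mul (hθ 1)))).add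
    (((continuous_fst.comp continuous_snd).mul ((h1.comp hp).mul (h1.comp hq))).mul (hθ 1))

/-- The parameters now range over a compact set independent of `θ`, and the conditions are weak
inequalities at every `t`, zeros of `Q` included, so they survive limits. -/
theorem exists_coeff_of_hasRationalLyapunov {lam θ : ℝ} {s : ℕ}
    (h : HasRationalLyapunov (rotatedCubic lam θ) s) :
    ∃ w : ℝ × (Fin (s + 1) → ℝ) × (Fin (s + 1) → ℝ),
      w ∈ Set.Icc (1 : ℝ) s ×ˢ Metric.sphere (0 : Fin (s + 1) → ℝ) 1 ×ˢ
        Metric.sphere (0 : Fin (s + 1) → ℝ) 1 ∧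
      ∀ t, 0 ≤ (Polynomial.ofFn (s + 1) w.2.1).eval t * (Polynomial.ofFn (s + 1) w.2.2).eval t ∧
        lieNumerator lam t (θ, w) ≤ 0 := by
  obtain ⟨k, P, Q, hk, hP, hQ, hPs, hQs, hPQ⟩ := exists_polynomial_of_hasRationalLyapunov h
  obtain ⟨α, c, hα, hc, rfl⟩ := Polynomial.exists_smul_ofFn_eq hP hPs
  obtain ⟨β, d, hβ, hd, rfl⟩ := Polynomial.exists_smul_ofFn_eq hQ hQs
  have hαβ := mul_pos hα hβ
  refine ⟨(k, c, d), ⟨hk, by simpa using hc, by simpa using hd⟩, fun t => ⟨?_, ?_⟩⟩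
  · refine Polynomial.nonneg_of_forall_eval_ne_zero hQ (R := fun t =>
      (Polynomial.ofFn (s + 1) c).eval t * (Polynomial.ofFn (s + 1) d).eval t)
      (by fun_prop) (fun t ht => ?_) t
    have := (hPQ t ht).1
    simp only [Polynomial.eval_smul, smul_eq_mul] at this
    refine le_of_mul_le_mul_left ?_ hαβ
    linear_combination this
  · rw [← neg_nonneg]
    refine Polynomial.nonneg_of_forall_eval_ne_zero hQ (R := fun t =>
      -lieNumerator lam t (θ, k, c, d)) ?_ (fun t ht => ?_) t
    · simp only [lieNumerator, rotatedCubic_zero_at, rotatedCubic_one_at, gradX, gradY]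
      fun_prop
    · have := (hPQ t ht).2
      simp only [Polynomial.eval_smul, smul_eq_mul, Polynomial.derivative_smul] at this
      refine le_of_mul_le_mul_left ?_ hαβ
      simp only [lieNumerator]
      linear_combination this

theorem exists_not_hasRationalLyapunov_rotatedCubic {lam : ℝ} (hlam : 0 < lam)
    (hirr : Irrational lam) (s : ℕ) :
    ∃ θ : ℝ, 0 < θ ∧ θ < Real.pi ∧ ¬ HasRationalLyapunov (rotatedCubic lam θ) s := by
  by_contra! hcon
  have hθ : ∀ n : ℕ, HasRationalLyapunov (rotatedCubic lam (1 / ((n : ℝ) + 1))) s := by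
    intro n
    refine hcon _ (by positivity) (lt_of_le_of_lt (b := 1) ?_ (by linarith [Real.pi_gt_three]))
    exact div_le_one_of_le₀ (by linarith [(Nat.cast_nonneg n : (0 : ℝ) ≤ n)]) (by positivity)
  choose w hw hle using fun n => exists_coeff_of_hasRationalLyapunov (hθ n)
  have hK : IsCompact (Set.Icc (1 : ℝ) s ×ˢ Metric.sphere (0 : Fin (s + 1) → ℝ) 1 ×ˢ
      Metric.sphere (0 : Fin (s + 1) → ℝ) 1) :=
    isCompact_Icc.prod ((isCompact_sphere _ _).prod (isCompact_sphere _ _))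
  obtain ⟨⟨k, c, d⟩, ⟨hk, hc, hd⟩, φ, hφ, hlim⟩ := hK.tendsto_subseq hw
  have hne : ∀ c : Fin (s + 1) → ℝ, c ∈ Metric.sphere (0 : Fin (s + 1) → ℝ) 1 →
      Polynomial.ofFn (s + 1) c ≠ 0 := by
    intro c hc h0
    have := Polynomial.injective_ofFn (R := ℝ) (s + 1) (h0.trans (map_zero _).symm)
    simp [this] at hc
  have hθlim : Tendsto (fun n => 1 / ((φ n : ℝ) + 1)) atTop (𝓝 0) :=
    tendsto_one_div_add_atTop_nhds_zero_nat.comp hφ.tendsto_atTop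
  refine false_of_nonneg_of_le hlam hirr (lt_of_lt_of_le one_pos hk.1) (hne c hc) (hne d hd)
    (fun t => ?_) (fun t => ?_)
  · have hcont : Continuous fun w : ℝ × (Fin (s + 1) → ℝ) × (Fin (s + 1) → ℝ) =>
        (Polynomial.ofFn (s + 1) w.2.1).eval t * (Polynomial.ofFn (s + 1) w.2.2).eval t :=
      ((Polynomial.continuous_eval_ofFn _ t).comp (by fun_prop)).mul
        ((Polynomial.continuous_eval_ofFn _ t).comp (by fun_prop))
    exact ge_of_tendsto' ((hcont.tendsto _).comp hlim) fun n => (hle (φ n) t).1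
  · have h := le_of_tendsto' (((continuous_lieNumerator lam t).tendsto (0, k, c, d)).comp
      (hθlim.prodMk_nhds hlim)) fun n => (hle (φ n) t).2
    -- At `θ = 0` Euler's identity gives `t * gradX + gradY = (2 lam + 2) u r` at `(t, 1)`, which is
    -- the coefficient of the Wronskian.
    simp only [lieNumerator, rotatedCubic_zero_at, rotatedCubic_one_at, Real.cos_zero,
      Real.sin_zero, gradX, gradY] at h
    unfold gradX
    linear_combination h

/-! ### Polynomial form of the field and the conclusion -/

/-- The components of `rotatedCubic lam θ` as polynomials. -/
noncomputable def cubicPolynomial (lam θ : ℝ) : Fin 2 → MvPolynomial (Fin 2) ℝ :=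
  open MvPolynomial in
  -- Exponents `0` and `1` are written out so that every term has the one shape whose homogeneity is
  -- checked by `a + b = 3`.
  ![C (-Real.cos θ * (2 * lam + 4)) * (X 0 ^ 2 * X 1 ^ 1) +
      C (-Real.cos θ * (2 * lam + 2)) * (X 0 ^ 0 * X 1 ^ 3) +
      C (-Real.sin θ * (4 * lam + 4)) * (X 0 ^ 3 * X 1 ^ 0) +
      C (-Real.sin θ * (4 * lam + 2)) * (X 0 ^ 1 * X 1 ^ 2),
    C (-Real.sin θ * (2 * lam + 4)) * (X 0 ^ 2 * X 1 ^ 1) +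
      C (-Real.sin θ * (2 * lam + 2)) * (X 0 ^ 0 * X 1 ^ 3) +
      C (Real.cos θ * (4 * lam + 4)) * (X 0 ^ 3 * X 1 ^ 0) +
      C (Real.cos θ * (4 * lam + 2)) * (X 0 ^ 1 * X 1 ^ 2)]

theorem isHomogeneous_cubicPolynomial (lam θ : ℝ) (i : Fin 2) :
    (cubicPolynomial lam θ i).IsHomogeneous 3 := by
  have h : ∀ (c : ℝ) (a b : ℕ), a + b = 3 →
      (MvPolynomial.C c * (MvPolynomial.X 0 ^ a * MvPolynomial.X 1 ^ b) :
        MvPolynomial (Fin 2) ℝ).IsHomogeneous 3 := by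
    intro c a b hab
    rw [← hab]
    exact ((MvPolynomial.isHomogeneous_X_pow 0 a).mul
      (MvPolynomial.isHomogeneous_X_pow 1 b)).C_mul c
  fin_cases i <;>
  exact (((h _ _ _ rfl).add (h _ _ _ rfl)).add (h _ _ _ rfl)).add (h _ _ _ rfl)

theorem polyField_cubicPolynomial (lam θ : ℝ) :
    polyField (cubicPolynomial lam θ) = rotatedCubic lam θ := by
  ext z i
  fin_cases i
  · simp [polyField, cubicPolynomial, rotatedCubic_zero, gradX, gradY]
    ring
  · simp [polyField, cubicPolynomial, rotatedCubic_one, gradX, gradY]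
    ring

theorem mainTheorem4 :
    (∀ lam : ℝ, 0 < lam → Irrational lam →
      (∀ θ : ℝ, 0 < θ → θ < Real.pi → AsymptoticallyStable (rotatedCubic lam θ)) ∧
      (∀ s : ℕ, ∃ θ : ℝ, 0 < θ ∧ θ < Real.pi ∧ ¬ HasRationalLyapunov (rotatedCubic lam θ) s)) ∧
    (¬ ∃ B : ℕ → ℕ → ℕ, ∀ (n d : ℕ) (F : Fin n → MvPolynomial (Fin n) ℝ),
      0 < d → (∀ i, (F i).IsHomogeneous d) → AsymptoticallyStable (polyField F) →
        HasRationalLyapunov (polyField F) (B n d)) := by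
  refine ⟨fun lam hlam hirr => ⟨fun θ hθ hθ' => asymptoticallyStable_rotatedCubic hlam hθ hθ',
    exists_not_hasRationalLyapunov_rotatedCubic hlam hirr⟩, ?_⟩
  rintro ⟨B, hB⟩
  -- Any positive irrational would serve; with `n = 2` and `d = 3` fixed, `B 2 3` would be a bound
  -- uniform in `θ`.
  have hpos : 0 < √(2 : ℝ) := by positivity
  obtain ⟨θ, hθ, hθ', hnot⟩ :=
    exists_not_hasRationalLyapunov_rotatedCubic hpos irrational_sqrt_two (B 2 3)
  refine hnot ?_
  rw [← polyField_cubicPolynomial]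
  refine hB 2 3 _ three_pos (isHomogeneous_cubicPolynomial _ θ) ?_
  rw [polyField_cubicPolynomial]
  exact asymptoticallyStable_rotatedCubic hpos hθ hθ'
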